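/- Let $(\mathcal A,\tau)$ be a unital complex $*$-algebra with a faithful tracial state $\tau$, and write $\tau\otimes\tau$ for the functional $x\otimes y\mapsto\tau(x)\tau(y)$ on $\mathcal A\otimes\mathcal A$ and $\operatorname{var}_\varphi(x)=\varphi\big((x-\varphi(x)1)^2\big)$ for the variance with respect to a linear functional $\varphi$ (we write $\operatorname{var}$ when $\varphi$ is clear). Let $(a_k)_{k\ge 1}$ be self-adjoint, free, identically distributed elements of $\mathcal A$ with mean $\tau(a_k)=\lambda$ and variance $\operatorname{var}(a_k)=\sigma^2\neq 0$. Then $$\operatorname{var}(a_1\otimes a_1)=\sigma^2(\sigma^2+2\lambda^2)>0 .$$ Let $\delta>0$ be its square root and put $$b_k=\frac1\delta\big(a_k\otimes a_k-\tau\otimes\tau(a_k\otimes a_k)\big)\quad(k\ge1),\qquad S_n=\frac1{\sqrt n}\sum_{k=1}^n b_k\quad(n\ge1).$$ There exist a unital complex $*$-algebra $\mathcal A'$ with a faithful tracial state $\tau'$ and a self-adjoint $\mathbf S\in\mathcal A'$ such that $S_n$ converges in distribution to $\mathbf S$, that is, $\tau\otimes\tau(S_n^m)\to\tau'(\mathbf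 S^m)$ as $n\to\infty$ for every integer $m\ge0$. The odd moments of $\mathbf S$ vanish, and for every integer $p\ge0$ $$\tau'(\mathbf S^{2p})=\sum_{\pi\in P_2(2p)}\tau\otimes\tau\big(b_{i_1}b_{i_2}\cdots b_{i_{2p}}\big),$$ where $P_2(2p)$ is the set of partitions of $\{1,\dots,2p\}$ all of whose blocks have two elements and where, for each $\pi$, $(i_1,\dots,i_{2p})=(i_1(\pi),\dots,i_{2p}(\pi))\in\{1,\dots,p\}^{2p}$ is any sequence such that, for $j\ne k$, $i_j=i_k$ if and only if $\{j,k\}\in\pi$ (such a sequence exists for every $\pi$). Moreover, the law of $\mathbf S$ depends only on $\lambda$ and $\sigma$: for any other sequence of self-adjoint, free, identically distributed variables with mean $\lambda$ and variance $\sigma^2$, in any unital complex $*$-algebra with a faithful tracial state, the correspondingly normalized sums also converge in distribution to $\mathbf S$. -/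

import Mathlib

open scoped TensorProduct ComplexOrder

universe u v

namespace TensorFreeCLT

/-- `τ` is a faithful tracial state on the unital complex `*`-algebra `A`, so that `(A, τ)` is a
(unital, faithful, tracial) noncommutative probability space. -/
structure IsFaithfulTracialState {A : Type*} [Ring A] [StarRing A] [Algebra ℂ A]
    (τ : A →ₗ[ℂ] ℂ) : Prop where
  map_one : τ 1 = 1
  nonneg : ∀ x : A, 0 ≤ τ (star x * x)
  faithful : ∀ x : A, τ (star x * x) = 0 → x = 0
  trace : ∀ x y : A, τ (x * y) = τ (y * x)

/-- Freeness of a family of unital subalgebras: alternating products of centered elements are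
centered. A word is a list of pairs `(index, element of the subalgebra with that index)`. -/
def FreeSubalgebras {ι A : Type*} [Ring A] [Algebra ℂ A] (τ : A →ₗ[ℂ] ℂ)
    (B : ι → Subalgebra ℂ A) : Prop :=
  ∀ w : List (ι × A), w ≠ [] → (w.map Prod.fst).IsChain (· ≠ ·) →
    (∀ z ∈ w, z.2 ∈ B z.1 ∧ τ z.2 = 0) → τ (w.map Prod.snd).prod = 0

/-- Random variables are free if the unital algebras that they generate are free. (For self-adjoint
variables these are also the generated `*`-algebras.) -/
def FreeVariables {ι A : Type*} [Ring A] [Algebra ℂ A] (τ : A →ₗ[ℂ] ℂ) (a : ι → A) : Prop :=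
  FreeSubalgebras τ fun k => Algebra.adjoin ℂ {a k}

/-- A sequence of self-adjoint, free, identically distributed random variables. -/
structure IsFreeIID {A : Type*} [Ring A] [StarRing A] [Algebra ℂ A]
    (τ : A →ₗ[ℂ] ℂ) (a : ℕ → A) : Prop where
  selfAdjoint : ∀ k, IsSelfAdjoint (a k)
  free : FreeVariables τ a
  identDistrib : ∀ k l p : ℕ, τ (a k ^ p) = τ (a l ^ p)

/-- The variance `τ ((x - τ x)²)`. -/
def variance {A : Type*} [Ring A] [Algebra ℂ A] (τ : A →ₗ[ℂ] ℂ) (x : A) : ℂ :=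
  τ ((x - algebraMap ℂ A (τ x)) ^ 2)

/-- Convergence in distribution (convergence of all moments) of a sequence in `(A, τ)` to a
variable of `(B, ρ)`. -/
def ConvergesInDistribution {A B : Type*} [Ring A] [Algebra ℂ A] [Ring B] [Algebra ℂ B]
    (τ : A →ₗ[ℂ] ℂ) (x : ℕ → A) (ρ : B →ₗ[ℂ] ℂ) (y : B) : Prop :=
  ∀ p : ℕ, Filter.Tendsto (fun n => τ (x n ^ p)) Filter.atTop (nhds (ρ (y ^ p)))

section Tensor

variable {A : Type*} [Ring A] [Algebra ℂ A]

/-- The functional `τ ⊗ τ` on `A ⊗ A`, given by `x ⊗ y ↦ τ x * τ y`. -/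
noncomputable def tensorState (τ : A →ₗ[ℂ] ℂ) : A ⊗[ℂ] A →ₗ[ℂ] ℂ :=
  LinearMap.mul' ℂ ℂ ∘ₗ TensorProduct.map τ τ

/-- `δ`, the nonnegative square root of `var (a₀ ⊗ a₀)`. Sequences are indexed from `0`. -/
noncomputable def tensorStdDev (τ : A →ₗ[ℂ] ℂ) (a : ℕ → A) : ℝ :=
  Real.sqrt (variance (tensorState τ) (a 0 ⊗ₜ[ℂ] a 0)).re

/-- `b k = δ⁻¹ (a k ⊗ a k - (τ ⊗ τ)(a k ⊗ a k))`. -/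
noncomputable def centeredTensor (τ : A →ₗ[ℂ] ℂ) (a : ℕ → A) (k : ℕ) : A ⊗[ℂ] A :=
  ((tensorStdDev τ a : ℝ) : ℂ)⁻¹ • (a k ⊗ₜ[ℂ] a k -
    algebraMap ℂ (A ⊗[ℂ] A) (tensorState τ (a k ⊗ₜ[ℂ] a k)))

/-- `S n = n^(-1/2) (b 0 + ⋯ + b (n - 1))`. -/
noncomputable def normalizedSum (τ : A →ₗ[ℂ] ℂ) (a : ℕ → A) (n : ℕ) : A ⊗[ℂ] A :=
  ((Real.sqrt (n : ℝ) : ℝ) : ℂ)⁻¹ • ∑ k ∈ Finset.range n, centeredTensor τ a k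

end Tensor

/-- The set `P₂(m)` of pair partitions of an `m`-element ordered set. -/
def pairPartitions (m : ℕ) : Finset (Finpartition (Finset.univ : Finset (Fin m))) :=
  Finset.univ.filter fun π => ∀ V ∈ π.parts, V.card = 2

/-- The index sequence `i` takes equal values exactly at positions in the same block of `π`. -/
def Indexes {m r : ℕ} (π : Finpartition (Finset.univ : Finset (Fin m))) (i : Fin m → Fin r) :
    Prop :=
  ∀ j k : Fin m, i j = i k ↔ ∃ V ∈ π.parts, j ∈ V ∧ k ∈ V

end TensorFreeCLT

/-! Put `x k = a k - λ`. Then `a k ⊗ a k - λ²` equals `x k ⊗ x k + λ (x k ⊗ 1 + 1 ⊗ x k)`, so a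
mixed moment of the `b k` is a finite sum of products of two moments of the free centered variables
`x k`, one for each tensor leg. The `b k` need not be free, but two properties survive from
freeness: a mixed moment depends only on which indices coincide, and it vanishes if some index
occurs exactly once.

These two properties suffice for a central limit theorem (`tendsto_normalized_sum_pow`). Grouping
the terms of `S_n ^ m` by the kernel partition `π` of the index sequence gives the weight `n^(-m/2)
n (n-1) ⋯ (n - |π| + 1)`. Partitions with a singleton contribute nothing; any other has `2|π| ≤ m`,
with equality exactly for pairings, so only pairings survive in the limit. Along a pairing each
index occurs at most twice in each leg, and such moments are determined by the variance of `x 0`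
(`moment_eq_of_count_le_two`); hence the limit depends only on `λ` and `σ`.

The limit is realized as a law because `τ ⊗ τ` is positive by the Schur product theorem. Positivity
on `ℂ[X]` passes to the limit, and dividing by the null ideal gives a faithful state. -/

namespace TensorFreeCLT

open Polynomial

/-! ### Mixed moments of free identically distributed variables. -/

section Words

variable {A B ι ι' κ : Type*} [Ring A] [Algebra ℂ A] [Ring B] [Algebra ℂ B]

/-- The product of the elements `p (x k)` over the letters `(k, p)` of a word. -/
noncomputable def wordEval (x : κ → A) (w : List (κ × ℂ[X])) : A :=
  (w.map fun z => aeval (x z.1) z.2).prod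

@[simp] lemma wordEval_nil (x : κ → A) : wordEval x [] = 1 := rfl

@[simp] lemma wordEval_cons (x : κ → A) (z : κ × ℂ[X]) (w : List (κ × ℂ[X])) :
    wordEval x (z :: w) = aeval (x z.1) z.2 * wordEval x w := by
  simp [wordEval]

@[simp] lemma wordEval_append (x : κ → A) (u w : List (κ × ℂ[X])) :
    wordEval x (u ++ w) = wordEval x u * wordEval x w := by
  simp [wordEval]

lemma wordEval_comp (x : ι → A) (f : κ → ι) (w : List (κ × ℂ[X])) :
    wordEval (x ∘ f) w = wordEval x (w.map (Prod.map f id)) := by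
  simp [wordEval, Function.comp_def]

/-- A family of free variables whose common law is given by the functional `μ` on polynomials,
with respect to a tracial functional. -/
structure IsFreeWithLaw (τ : A →ₗ[ℂ] ℂ) (x : ι → A) (μ : ℂ[X] →ₗ[ℂ] ℂ) : Prop where
  map_one : τ 1 = 1
  trace : ∀ y z : A, τ (y * z) = τ (z * y)
  law : ∀ k p, τ (aeval (x k) p) = μ p
  free : ∀ w : List (ι × ℂ[X]), w ≠ [] → (w.map Prod.fst).IsChain (· ≠ ·) →
    (∀ z ∈ w, μ z.2 = 0) → τ (wordEval x w) = 0

lemma exists_adjacent_of_not_isChain {α : Type*} {r : α → α → Prop} {l : List α}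
    (h : ¬ l.IsChain r) : ∃ u v a b, l = u ++ a :: b :: v ∧ ¬ r a b := by
  induction l with
  | nil => simp at h
  | cons a l ih =>
    cases l with
    | nil => simp at h
    | cons b l =>
      by_cases hab : r a b
      · obtain ⟨u, v, c, d, hl, hcd⟩ := ih (fun h' => h (by simp [hab, h']))
        exact ⟨a :: u, v, c, d, by simp [hl], hcd⟩
      · exact ⟨[], l, a, b, rfl, hab⟩

/-- Induction on words: reduction to alternating words with centered letters, by merging adjacent
letters with equal indices and by centering letters. -/
theorem word_induction (f : κ → ι) (μ : ℂ[X] →ₗ[ℂ] ℂ) (hμ : μ 1 = 1)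
    {P : List (κ × ℂ[X]) → Prop}
    (base : ∀ w, (w.map (f ∘ Prod.fst)).IsChain (· ≠ ·) → (∀ z ∈ w, μ z.2 = 0) → P w)
    (merge : ∀ u v j k p q, f j = f k → P (u ++ (j, p * q) :: v) →
      P (u ++ (j, p) :: (k, q) :: v))
    (center : ∀ u v j p, P (u ++ (j, p - C (μ p)) :: v) → P (u ++ v) → P (u ++ (j, p) :: v))
    (w : List (κ × ℂ[X])) : P w := by
  classical
  -- Length has weight 2 because merging two centered letters may create one non-centered letter;
  -- the measure still drops.
  induction hN : 2 * w.length + w.countP (fun z => μ z.2 ≠ 0) using Nat.strong_induction_on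
    generalizing w with
  | _ N ih =>
    subst hN
    by_cases hc : (w.map (f ∘ Prod.fst)).IsChain (· ≠ ·)
    · by_cases hz : ∀ z ∈ w, μ z.2 = 0
      · exact base w hc hz
      · push Not at hz
        obtain ⟨⟨j, p⟩, hz, hp⟩ := hz
        obtain ⟨u, v, rfl⟩ := List.append_of_mem hz
        have h0 : μ (p - C (μ p)) = 0 := by
          rw [map_sub, ← mul_one (C (μ p)), ← smul_eq_C_mul, map_smul, hμ]; simp
        refine center u v j p (ih _ ?_ _ rfl) (ih _ ?_ _ rfl)
        · simp only [List.length_append, List.length_cons, List.countP_append, List.countP_cons,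
            h0]
          simp [show μ p ≠ 0 from hp]
        · simp only [List.length_append, List.length_cons, List.countP_append, List.countP_cons]
          omega
    · rw [List.isChain_map] at hc
      obtain ⟨u, v, ⟨j, p⟩, ⟨k, q⟩, rfl, h⟩ := exists_adjacent_of_not_isChain hc
      refine merge u v j k p q (by simpa using h) (ih _ ?_ _ rfl)
      simp only [List.length_append, List.length_cons, List.countP_append, List.countP_cons]
      split_ifs <;> omega

variable {τ : A →ₗ[ℂ] ℂ} {x : ι → A} {μ : ℂ[X] →ₗ[ℂ] ℂ}
  {ρ : B →ₗ[ℂ] ℂ} {y : ι' → B} {ν : ℂ[X] →ₗ[ℂ] ℂ}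

namespace IsFreeWithLaw

lemma law_one (h : IsFreeWithLaw τ x μ) [Nonempty ι] : μ 1 = 1 := by
  rw [← h.law (Classical.arbitrary ι), _root_.map_one, h.map_one]

/-- Mixed moments of free identically distributed variables depend only on the law and on which
indices coincide. -/
theorem moment_eq [Nonempty ι] (hx : IsFreeWithLaw τ x μ) (hy : IsFreeWithLaw ρ y μ)
    {f : κ → ι} {g : κ → ι'} (hfg : ∀ j k, f j = f k ↔ g j = g k) (w : List (κ × ℂ[X])) :
    τ (wordEval (x ∘ f) w) = ρ (wordEval (y ∘ g) w) := by
  induction w using word_induction f μ hx.law_one with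
  | base w hc hz =>
    rcases eq_or_ne w [] with rfl | hw
    · simp [hx.map_one, hy.map_one]
    rw [wordEval_comp, wordEval_comp, hx.free _ (by simpa) (by simpa [Function.comp_def] using hc)
      (List.forall_mem_map.2 fun z h => hz z h),
      hy.free _ (by simpa) _ (List.forall_mem_map.2 fun z h => hz z h)]
    rw [List.map_map, List.isChain_map]
    rw [List.isChain_map] at hc
    exact hc.imp fun a b hab => by simpa [← hfg] using hab
  | merge u v j k p q hjk h =>
    have hg := (hfg j k).1 hjk
    simpa [hjk, hg, mul_assoc] using h
  | center u v j p h1 h2 =>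
    simp only [wordEval_append, wordEval_cons, map_sub, sub_mul, mul_sub, aeval_C,
      Algebra.algebraMap_eq_smul_one, smul_mul_assoc, mul_smul_comm, one_mul, map_smul] at h1 h2 ⊢
    rw [h2] at h1
    exact sub_left_injective h1

/-- Merging and centering inside `w` never introduce the index `k`, so the leading centered letter
stays isolated until the whole word is alternating and centered. -/
lemma moment_cons_eq_zero (hx : IsFreeWithLaw τ x μ) {k : ι} {p : ℂ[X]} (hp : μ p = 0)
    (w : List (ι × ℂ[X])) (hw : ∀ z ∈ w, z.1 ≠ k) :
    τ (aeval (x k) p * wordEval x w) = 0 := by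
  have : Nonempty ι := ⟨k⟩
  induction w using word_induction id μ hx.law_one with
  | base w hc hz =>
    rw [← wordEval_cons x (k, p)]
    refine hx.free _ (by simp) ?_ (by simpa [hp] using hz)
    cases w with
    | nil => simp
    | cons z w =>
      rw [List.map_cons, List.map_cons, List.isChain_cons_cons]
      exact ⟨(hw z (by simp)).symm, by simpa using hc⟩
  | merge u v j l q r hjl h =>
    obtain rfl : j = l := hjl
    have := h (by simpa only [List.forall_mem_append, List.forall_mem_cons, and_self_left] using hw)
    simpa [mul_assoc] using this
  | center u v j q h1 h2 =>
    have h1 := h1 (by simpa only [List.forall_mem_append, List.forall_mem_cons] using hw)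
    have h2 := h2 (fun z hz => hw z (by
      simp only [List.mem_append, List.mem_cons] at hz ⊢; tauto))
    simp only [wordEval_append, wordEval_cons, map_sub, sub_mul, mul_sub, aeval_C,
      Algebra.algebraMap_eq_smul_one, smul_mul_assoc, mul_smul_comm, one_mul, map_smul] at h1 h2 ⊢
    simpa [h2] using h1

/-- A moment vanishes if some letter is centered and no other letter has the same index. -/
theorem moment_eq_zero (hx : IsFreeWithLaw τ x μ) {k : ι} {p : ℂ[X]} (hp : μ p = 0)
    {u v : List (ι × ℂ[X])} (hu : ∀ z ∈ u, z.1 ≠ k) (hv : ∀ z ∈ v, z.1 ≠ k) :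
    τ (wordEval x (u ++ (k, p) :: v)) = 0 := by
  -- Traciality rotates the isolated letter to the front.
  rw [wordEval_append, hx.trace, wordEval_cons, mul_assoc, ← wordEval_append]
  refine hx.moment_cons_eq_zero hp _ fun z hz => ?_
  rcases List.mem_append.1 hz with hz | hz
  exacts [hv z hz, hu z hz]

/-- The polynomial `X ^ 2 - μ (X ^ 2)` is centered, and its index occurs nowhere else, so
`moment_eq_zero` applies. -/
lemma moment_square (hx : IsFreeWithLaw τ x μ) {k : ι} {l₁ l₂ : List ι}
    (h₁ : k ∉ l₁) (h₂ : k ∉ l₂) :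
    τ ((l₁.map x).prod * (x k * (x k * (l₂.map x).prod))) =
      μ (X ^ 2) * τ ((l₁.map x).prod * (l₂.map x).prod) := by
  have : Nonempty ι := ⟨k⟩
  have hp : μ (X ^ 2 - C (μ (X ^ 2))) = 0 := by
    rw [map_sub, ← mul_one (C (μ (X ^ 2))), ← smul_eq_C_mul, map_smul, hx.law_one]; simp
  have := hx.moment_eq_zero hp (k := k) (u := l₁.map fun j => (j, X)) (v := l₂.map fun j => (j, X))
    (List.forall_mem_map.2 fun j hj h => h₁ (h ▸ hj))
    (List.forall_mem_map.2 fun j hj h => h₂ (h ▸ hj))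
  simp only [wordEval, List.map_append, List.map_cons, List.map_map, Function.comp_def, aeval_X,
    List.prod_append, List.prod_cons, map_sub, map_pow, sub_mul, mul_sub, aeval_C,
    Algebra.algebraMap_eq_smul_one, smul_mul_assoc, mul_smul_comm, one_mul, map_smul,
    smul_eq_mul, sub_eq_zero] at this
  simpa [pow_two, mul_assoc] using this

/-- Moments in which every variable occurs at most twice depend only on the variance (for centered
variables). -/
theorem moment_eq_of_count_le_two [DecidableEq ι]
    (hx : IsFreeWithLaw τ x μ) (hy : IsFreeWithLaw ρ y ν)
    (hμ : μ X = 0) (hν : ν X = 0) (h2 : μ (X ^ 2) = ν (X ^ 2))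
    {f : κ → ι} {g : κ → ι'} (hfg : ∀ j k, f j = f k ↔ g j = g k) (l : List κ)
    (hl : ∀ i, (l.map f).count i ≤ 2) :
    τ (l.map (x ∘ f)).prod = ρ (l.map (y ∘ g)).prod := by
  induction hN : l.length using Nat.strong_induction_on generalizing l with
  | _ N ih =>
    subst hN
    -- An alternating word in centered variables has moment zero on both sides. Otherwise an
    -- adjacent equal pair exhausts the occurrences of its index, and `moment_square` extracts the
    -- variance and leaves a shorter word.
    by_cases hc : l.IsChain fun j k => f j ≠ f k
    · rcases eq_or_ne l [] with rfl | hne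
      · simp [hx.map_one, hy.map_one]
      have e1 := hx.free (l.map fun j => (f j, X)) (by simpa)
        (by rw [List.map_map, List.isChain_map]; exact hc) (by simpa using fun _ _ => hμ)
      have e2 := hy.free (l.map fun j => (g j, X)) (by simpa)
        (by
          rw [List.map_map, List.isChain_map]
          exact hc.imp fun a b hab => by simpa [← hfg] using hab) (by simpa using fun _ _ => hν)
      simp only [wordEval, List.map_map, Function.comp_def, aeval_X] at e1 e2 ⊢
      rw [e1, e2]
    · obtain ⟨l₁, l₂, j, k, rfl, hjk⟩ := exists_adjacent_of_not_isChain hc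
      have hjk : f j = f k := by simpa using hjk
      have hc2 := hl (f j)
      simp only [List.map_append, List.map_cons, List.count_append, List.count_cons, hjk] at hc2
      have h1 : f j ∉ l₁.map f := by
        rw [← List.count_eq_zero, hjk]; simp at hc2; omega
      have h2' : f j ∉ l₂.map f := by
        rw [← List.count_eq_zero, hjk]; simp at hc2; omega
      have hg : ∀ l : List κ, f j ∉ l.map f → g j ∉ l.map g := by
        intro l h h'
        obtain ⟨i, hi, hij⟩ := List.mem_map.1 h'
        exact h (List.mem_map.2 ⟨i, hi, (hfg _ _).2 hij⟩)
      have ih' := ih _ (by simp) (l₁ ++ l₂) (fun i => (List.Sublist.count_le i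
        ((List.Sublist.append_left (by simp) l₁).map f)).trans
          (hl i)) rfl
      have e1 := hx.moment_square h1 h2'
      have e2 := hy.moment_square (hg _ h1) (hg _ h2')
      simp only [List.map_map] at e1 e2
      simp only [List.map_append, List.prod_append] at ih'
      simp only [List.map_append, List.map_cons, List.prod_append, List.prod_cons,
        Function.comp_apply, ← hjk, ← (hfg j k).1 hjk, e1, e2, h2, ih']

end IsFreeWithLaw

end Words
end TensorFreeCLT

namespace TensorFreeCLT

open Polynomial

/-! ### Mixed moments in the tensor square. -/

section TensorMoments

variable {A B ι ι' : Type*} [Ring A] [Algebra ℂ A] [Ring B] [Algebra ℂ B] {m : ℕ}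
  {τ : A →ₗ[ℂ] ℂ} {x : ι → A} {μ : ℂ[X] →ₗ[ℂ] ℂ}
  {ρ : B →ₗ[ℂ] ℂ} {y : ι' → B} {ν : ℂ[X] →ₗ[ℂ] ℂ}

lemma prod_ofFn_pow_eq_wordEval (x : ι → A) (i : Fin m → ι) (e : Fin m → ℕ) :
    (List.ofFn fun j => x (i j) ^ e j).prod =
      wordEval (x ∘ i) ((List.finRange m).map fun j => (j, X ^ e j)) := by
  simp [wordEval, List.ofFn_eq_map, Function.comp_def]

lemma IsFreeWithLaw.moment_pow_eq (hx : IsFreeWithLaw τ x μ) {i i' : Fin m → ι}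
    (h : ∀ j k, i j = i k ↔ i' j = i' k) (e : Fin m → ℕ) :
    τ (List.ofFn fun j => x (i j) ^ e j).prod = τ (List.ofFn fun j => x (i' j) ^ e j).prod := by
  rcases isEmpty_or_nonempty ι with hι | hι
  · obtain rfl : i = i' := funext fun j => hι.elim (i j)
    rfl
  rw [prod_ofFn_pow_eq_wordEval, prod_ofFn_pow_eq_wordEval]
  exact hx.moment_eq hx h _

lemma IsFreeWithLaw.moment_pow_eq_zero (hx : IsFreeWithLaw τ x μ) (hμ : μ X = 0)
    {i : Fin m → ι} {k : Fin m} (hk : ∀ j, j ≠ k → i j ≠ i k) {e : Fin m → ℕ} (he : e k = 1) :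
    τ (List.ofFn fun j => x (i j) ^ e j).prod = 0 := by
  obtain ⟨u, v, huv⟩ := List.append_of_mem (List.mem_finRange k)
  have hnd := List.nodup_finRange m
  rw [huv, List.nodup_append, List.nodup_cons] at hnd
  rw [prod_ofFn_pow_eq_wordEval, wordEval_comp, huv]
  simp only [List.map_append, List.map_cons, he, pow_one, Prod.map_apply, id]
  refine hx.moment_eq_zero hμ ?_ ?_
  · simp only [List.map_map, List.forall_mem_map]
    exact fun j hj => hk j (hnd.2.2 j hj k (by simp))
  · simp only [List.map_map, List.forall_mem_map]
    exact fun j hj => hk j fun h => hnd.2.1.1 (h ▸ hj)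

lemma prod_map_pow_eq_filter {R κ : Type*} [Monoid R] (z : κ → R) {e : κ → ℕ} (he : ∀ j, e j ≤ 1)
    (l : List κ) : (l.map fun j => z j ^ e j).prod = ((l.filter fun j => e j = 1).map z).prod := by
  induction l with
  | nil => simp
  | cons j l ih =>
    rcases Nat.le_one_iff_eq_zero_or_eq_one.1 (he j) with h | h <;> simp [h, ih]

lemma IsFreeWithLaw.moment_pow_eq_of_card_le_two [DecidableEq ι]
    (hx : IsFreeWithLaw τ x μ) (hy : IsFreeWithLaw ρ y ν)
    (hμ : μ X = 0) (hν : ν X = 0) (h2 : μ (X ^ 2) = ν (X ^ 2))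
    {i : Fin m → ι} {i' : Fin m → ι'} (h : ∀ j k, i j = i k ↔ i' j = i' k)
    (hi : ∀ v, (Finset.univ.filter fun j => i j = v).card ≤ 2)
    {e : Fin m → ℕ} (he : ∀ j, e j ≤ 1) :
    τ (List.ofFn fun j => x (i j) ^ e j).prod = ρ (List.ofFn fun j => y (i' j) ^ e j).prod := by
  rw [List.ofFn_eq_map, List.ofFn_eq_map, prod_map_pow_eq_filter (fun j => x (i j)) he,
    prod_map_pow_eq_filter (fun j => y (i' j)) he]
  refine hx.moment_eq_of_count_le_two hy hμ hν h2 h _ fun v => ?_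
  refine ((List.filter_sublist.map i).count_le v).trans (le_trans (le_of_eq ?_) (hi v))
  rw [List.count, List.countP_map, List.countP_eq_length_filter,
    ← List.toFinset_card_of_nodup ((List.nodup_finRange m).filter _)]
  congr 1
  ext j
  simp

lemma prod_ofFn_tmul (f : Fin m → A) (g : Fin m → B) :
    (List.ofFn fun j => f j ⊗ₜ[ℂ] g j).prod = (List.ofFn f).prod ⊗ₜ[ℂ] (List.ofFn g).prod := by
  induction m with
  | zero => simp [Algebra.TensorProduct.one_def]
  | succ m ih => simp [List.ofFn_succ, ih]

lemma tensorState_tmul (τ : A →ₗ[ℂ] ℂ) (y z : A) : tensorState τ (y ⊗ₜ[ℂ] z) = τ y * τ z := by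
  simp [tensorState]

/-- `r x⊗x + s (x⊗1 + 1⊗x)`. -/
noncomputable def symmTensor (r s : ℂ) (x : A) : A ⊗[ℂ] A :=
  ∑ t : Fin 3, (![r, s, s] t) • ((x ^ (![1, 1, 0] t : ℕ)) ⊗ₜ[ℂ] (x ^ (![1, 0, 1] t : ℕ)))

lemma symmTensor_eq (r s : ℂ) (x : A) :
    symmTensor r s x = r • x ⊗ₜ[ℂ] x + s • x ⊗ₜ[ℂ] 1 + s • 1 ⊗ₜ[ℂ] x := by
  simp [symmTensor, Fin.sum_univ_three]

/-- Multilinear expansion: `t j` chooses one of the three summands at position `j`. Writing the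
summands with exponents 0 or 1 gives the words in both legs a uniform shape. -/
lemma tensorState_prod_symmTensor (r s : ℂ) (x : ι → A) (i : Fin m → ι) :
    tensorState τ (List.ofFn fun j => symmTensor r s (x (i j))).prod =
      ∑ t : Fin m → Fin 3, (∏ j, (![r, s, s] (t j))) *
        (τ (List.ofFn fun j => x (i j) ^ (![1, 1, 0] (t j) : ℕ)).prod *
         τ (List.ofFn fun j => x (i j) ^ (![1, 0, 1] (t j) : ℕ)).prod) := by
  rw [← MultilinearMap.mkPiAlgebraFin_apply (R := ℂ)]
  unfold symmTensor
  rw [MultilinearMap.map_sum, map_sum]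
  refine Finset.sum_congr rfl fun t _ => ?_
  rw [MultilinearMap.map_smul_univ, map_smul, MultilinearMap.mkPiAlgebraFin_apply, prod_ofFn_tmul,
    tensorState_tmul, smul_eq_mul]

lemma IsFreeWithLaw.tensorState_prod_eq (hx : IsFreeWithLaw τ x μ) (r s : ℂ) {i i' : Fin m → ι}
    (h : ∀ j k, i j = i k ↔ i' j = i' k) :
    tensorState τ (List.ofFn fun j => symmTensor r s (x (i j))).prod =
      tensorState τ (List.ofFn fun j => symmTensor r s (x (i' j))).prod := by
  rw [tensorState_prod_symmTensor, tensorState_prod_symmTensor]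
  refine Finset.sum_congr rfl fun t _ => ?_
  rw [hx.moment_pow_eq h, hx.moment_pow_eq h]

/-- Each of the three summands contains `x` in at least one leg, and the factor from that leg
vanishes because `k` is isolated. -/
lemma IsFreeWithLaw.tensorState_prod_eq_zero (hx : IsFreeWithLaw τ x μ) (hμ : μ X = 0) (r s : ℂ)
    {i : Fin m → ι} {k : Fin m} (hk : ∀ j, j ≠ k → i j ≠ i k) :
    tensorState τ (List.ofFn fun j => symmTensor r s (x (i j))).prod = 0 := by
  rw [tensorState_prod_symmTensor]
  refine Finset.sum_eq_zero fun t _ => ?_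
  have : (![1, 1, 0] (t k) : ℕ) = 1 ∨ (![1, 0, 1] (t k) : ℕ) = 1 := by
    generalize t k = a
    revert a
    decide
  rcases this with h | h
  · rw [hx.moment_pow_eq_zero hμ hk h, zero_mul, mul_zero]
  · rw [hx.moment_pow_eq_zero (e := fun j => ![1, 0, 1] (t j)) hμ hk h, mul_zero, mul_zero]

lemma IsFreeWithLaw.tensorState_prod_eq_of_card_le_two [DecidableEq ι]
    (hx : IsFreeWithLaw τ x μ) (hy : IsFreeWithLaw ρ y ν)
    (hμ : μ X = 0) (hν : ν X = 0) (h2 : μ (X ^ 2) = ν (X ^ 2)) (r s : ℂ)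
    {i : Fin m → ι} {i' : Fin m → ι'} (h : ∀ j k, i j = i k ↔ i' j = i' k)
    (hi : ∀ v, (Finset.univ.filter fun j => i j = v).card ≤ 2) :
    tensorState τ (List.ofFn fun j => symmTensor r s (x (i j))).prod =
      tensorState ρ (List.ofFn fun j => symmTensor r s (y (i' j))).prod := by
  rw [tensorState_prod_symmTensor, tensorState_prod_symmTensor]
  refine Finset.sum_congr rfl fun t _ => ?_
  have h1 : ∀ a, (![1, 1, 0] a : ℕ) ≤ 1 := by decide
  have h1' : ∀ a, (![1, 0, 1] a : ℕ) ≤ 1 := by decide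
  rw [hx.moment_pow_eq_of_card_le_two hy hμ hν h2 h hi fun j => h1 (t j),
    hx.moment_pow_eq_of_card_le_two hy hμ hν h2 h hi fun j => h1' (t j)]

end TensorMoments

/-! ### Centering the given sequence and computing the variance. -/

section FreeIID

variable {A : Type*} [Ring A] [StarRing A] [Algebra ℂ A] {τ : A →ₗ[ℂ] ℂ} {a : ℕ → A} {lam σ : ℂ}

/-- A polynomial in `a k - lam` is a polynomial in `a k`, so it lies in the free subalgebra, and
equality of power moments extends to it by linearity. -/
lemma IsFreeIID.isFreeWithLaw_sub (hτ : IsFaithfulTracialState τ) (ha : IsFreeIID τ a) (lam : ℂ) :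
    IsFreeWithLaw τ (fun k => a k - algebraMap ℂ A lam)
      (τ ∘ₗ (aeval (a 0 - algebraMap ℂ A lam)).toLinearMap) where
  map_one := hτ.map_one
  trace := hτ.trace
  law k p := by
    have h : ∀ k, aeval (a k - algebraMap ℂ A lam) p = aeval (a k) (p.comp (X - C lam)) := by
      simp [aeval_comp]
    simp only [LinearMap.comp_apply, AlgHom.toLinearMap_apply, h, aeval_eq_sum_range, map_sum,
      map_smul, ha.identDistrib k 0]
  free w hw hc hz := by
    have := ha.free (w.map fun z => (z.1, aeval (a z.1 - algebraMap ℂ A lam) z.2)) (by simpa)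
      (by simpa [Function.comp_def] using hc) ?_
    · simpa [wordEval, Function.comp_def] using this
    · rw [List.forall_mem_map]
      refine fun z hzw => ⟨?_, ?_⟩
      · have : aeval (a z.1 - algebraMap ℂ A lam) z.2 = aeval (a z.1) (z.2.comp (X - C lam)) := by
          simp [aeval_comp]
        dsimp only
        rw [this]
        exact aeval_mem_adjoin_singleton _ _
      · have h : ∀ k (p : ℂ[X]),
            aeval (a k - algebraMap ℂ A lam) p = aeval (a k) (p.comp (X - C lam)) := by
          simp [aeval_comp]
        have h0 := hz z hzw
        simp only [LinearMap.comp_apply, AlgHom.toLinearMap_apply, h, aeval_eq_sum_range, map_sum,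
          map_smul] at h0 ⊢
        simpa only [ha.identDistrib z.1 0] using h0

lemma IsFreeIID.mean_eq (ha : IsFreeIID τ a) (hmean : τ (a 0) = lam) (k : ℕ) : τ (a k) = lam := by
  simpa [hmean] using ha.identDistrib k 0 1

lemma IsFaithfulTracialState.apply_sq (hτ : IsFaithfulTracialState τ)
    (hmean : τ (a 0) = lam) (hvar : variance τ (a 0) = σ ^ 2) :
    τ (a 0 ^ 2) = σ ^ 2 + lam ^ 2 := by
  rw [← hvar, variance, hmean]
  simp only [sq, sub_mul, mul_sub, Algebra.algebraMap_eq_smul_one, smul_mul_assoc, mul_smul_comm,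
    one_mul, mul_one, map_sub, map_smul, hmean, hτ.map_one, smul_eq_mul]
  ring

lemma IsFaithfulTracialState.variance_tensor (hτ : IsFaithfulTracialState τ)
    (hmean : τ (a 0) = lam) (hvar : variance τ (a 0) = σ ^ 2) :
    variance (tensorState τ) (a 0 ⊗ₜ[ℂ] a 0) = σ ^ 2 * (σ ^ 2 + 2 * lam ^ 2) := by
  have h := hτ.apply_sq hmean hvar
  simp only [sq, variance, sub_mul, mul_sub, Algebra.algebraMap_eq_smul_one, smul_mul_assoc,
    mul_smul_comm, Algebra.TensorProduct.tmul_mul_tmul, Algebra.TensorProduct.one_def,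
    one_mul, mul_one, map_sub, map_smul, tensorState_tmul, hmean, hτ.map_one, smul_eq_mul] at h ⊢
  rw [h]
  ring

lemma IsFreeIID.centeredTensor_eq (ha : IsFreeIID τ a) (hmean : τ (a 0) = lam) (k : ℕ) :
    centeredTensor τ a k = symmTensor ((tensorStdDev τ a : ℝ) : ℂ)⁻¹
      (((tensorStdDev τ a : ℝ) : ℂ)⁻¹ * lam) (a k - algebraMap ℂ A lam) := by
  rw [centeredTensor, symmTensor_eq, tensorState_tmul, ha.mean_eq hmean]
  simp only [Algebra.algebraMap_eq_smul_one, TensorProduct.sub_tmul, TensorProduct.tmul_sub,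
    ← TensorProduct.smul_tmul', TensorProduct.tmul_smul, Algebra.TensorProduct.one_def]
  module

end FreeIID
end TensorFreeCLT

namespace TensorFreeCLT

open Filter Topology

/-! ### Kernel partitions of index sequences and pairings. -/

section Partitions

variable {m : ℕ} {α : Type*}

/-- The partition of the positions of a sequence into the sets where it is constant. -/
noncomputable def kernelPartition (i : Fin m → α) :
    Finpartition (Finset.univ : Finset (Fin m)) := by
  classical exact Finpartition.ofSetoid (Setoid.ker i)

lemma kernelPartition_part_eq_iff (i : Fin m → α) (j k : Fin m) :
    (kernelPartition i).part j = (kernelPartition i).part k ↔ i j = i k := by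
  classical
  rw [← Finpartition.mem_part_iff_part_eq_part _ (Finset.mem_univ _) (Finset.mem_univ _),
    kernelPartition, Finpartition.mem_part_ofSetoid_iff_rel, Setoid.ker_def, eq_comm]

lemma finpartition_eq_of_part_eq_iff {π ρ : Finpartition (Finset.univ : Finset (Fin m))}
    (h : ∀ j k, π.part j = π.part k ↔ ρ.part j = ρ.part k) : π = ρ := by
  have hpart : ∀ j, π.part j = ρ.part j := fun j => by
    ext k
    rw [Finpartition.mem_part_iff_part_eq_part _ (Finset.mem_univ _) (Finset.mem_univ _), h,
      Finpartition.mem_part_iff_part_eq_part _ (Finset.mem_univ _) (Finset.mem_univ _)]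
  have key : ∀ {π ρ : Finpartition (Finset.univ : Finset (Fin m))},
      (∀ j, π.part j = ρ.part j) → π.parts ⊆ ρ.parts := fun {π ρ} h V hV => by
    obtain ⟨j, hj⟩ := π.nonempty_of_mem_parts hV
    rw [← π.part_eq_of_mem hV hj, h]
    exact ρ.part_mem.2 (Finset.mem_univ _)
  exact Finpartition.ext ((key hpart).antisymm (key fun j => (hpart j).symm))

lemma kernelPartition_eq_iff (i : Fin m → α) (π : Finpartition (Finset.univ : Finset (Fin m))) :
    kernelPartition i = π ↔ ∀ j k, i j = i k ↔ π.part j = π.part k := by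
  refine ⟨?_, fun h => finpartition_eq_of_part_eq_iff fun j k => ?_⟩
  · rintro rfl j k
    exact (kernelPartition_part_eq_iff i j k).symm
  · rw [kernelPartition_part_eq_iff, h]

lemma exists_mem_parts_iff (π : Finpartition (Finset.univ : Finset (Fin m))) (j k : Fin m) :
    (∃ V ∈ π.parts, j ∈ V ∧ k ∈ V) ↔ π.part j = π.part k := by
  rw [← Finpartition.mem_part_iff_part_eq_part _ (Finset.mem_univ _) (Finset.mem_univ _),
    Finpartition.mem_part_iff_exists]

lemma indexes_iff {r : ℕ} (π : Finpartition (Finset.univ : Finset (Fin m))) (i : Fin m → Fin r) :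
    Indexes π i ↔ ∀ j k, i j = i k ↔ π.part j = π.part k := by
  simp only [Indexes, exists_mem_parts_iff]

/-- A sequence with kernel `π` is the same as an injection from the blocks of `π` into `Fin n`. -/
lemma card_kernelPartition_eq (π : Finpartition (Finset.univ : Finset (Fin m))) (n : ℕ) :
    Nat.card {i : Fin m → Fin n // kernelPartition i = π} =
      n.descFactorial π.parts.card := by
  classical
  let F : (π.parts ↪ Fin n) → {i : Fin m → Fin n // kernelPartition i = π} := fun e =>
    ⟨fun j => e ⟨π.part j, π.part_mem.2 (Finset.mem_univ j)⟩, by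
      rw [kernelPartition_eq_iff]
      simp⟩
  have hF : Function.Bijective F := by
    constructor
    · intro e e' h
      ext ⟨V, hV⟩
      obtain ⟨j, hj⟩ := π.nonempty_of_mem_parts hV
      have := congrFun (congrArg Subtype.val h) j
      simp only [F, π.part_eq_of_mem hV hj] at this
      rw [this]
    · rintro ⟨i, hi⟩
      rw [kernelPartition_eq_iff] at hi
      choose c hc using fun V : π.parts => π.nonempty_of_mem_parts V.2
      have hcV : ∀ V, π.part (c V) = V := fun V => π.part_eq_of_mem V.2 (hc V)
      refine ⟨⟨fun V => i (c V), fun V W h => ?_⟩, ?_⟩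
      · simp only [hi, hcV] at h
        exact Subtype.ext h
      · ext1
        funext j
        exact (hi _ _).2 (hcV _)
  rw [← Nat.card_congr (Equiv.ofBijective F hF), Nat.card_eq_fintype_card,
    Fintype.card_embedding_eq]
  simp

lemma mem_pairPartitions {π : Finpartition (Finset.univ : Finset (Fin m))} :
    π ∈ pairPartitions m ↔ ∀ V ∈ π.parts, V.card = 2 := by
  simp [pairPartitions]

lemma two_mul_card_parts_of_mem_pairPartitions
    {π : Finpartition (Finset.univ : Finset (Fin m))} (h : π ∈ pairPartitions m) :
    2 * π.parts.card = m := by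
  have h1 := π.sum_card_parts
  rw [Finset.sum_congr rfl (mem_pairPartitions.1 h)] at h1
  simp at h1
  omega

lemma two_mul_card_parts_lt {π : Finpartition (Finset.univ : Finset (Fin m))}
    (h : π ∉ pairPartitions m) (h1 : ∀ V ∈ π.parts, V.card ≠ 1) : 2 * π.parts.card < m := by
  rw [mem_pairPartitions] at h
  push Not at h
  obtain ⟨W, hW, hW2⟩ := h
  have h2 : ∀ V ∈ π.parts, 2 ≤ V.card := fun V hV => by
    have := Finset.card_pos.2 (π.nonempty_of_mem_parts hV)
    have := h1 V hV
    omega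
  have h3 := π.sum_card_parts
  have h4 : ∑ V ∈ π.parts, 2 < ∑ V ∈ π.parts, V.card :=
    Finset.sum_lt_sum h2 ⟨W, hW, by have := h2 W hW; omega⟩
  simp at h3 h4
  omega

/-- A pairing of `2 * p` points has `p` blocks, so there are `p! > 0` such sequences. -/
lemma exists_indexes {p : ℕ} {π : Finpartition (Finset.univ : Finset (Fin (2 * p)))}
    (h : π ∈ pairPartitions (2 * p)) : ∃ i : Fin (2 * p) → Fin p, Indexes π i := by
  have h1 := two_mul_card_parts_of_mem_pairPartitions h
  have h2 := card_kernelPartition_eq π p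
  rw [show π.parts.card = p by omega, Nat.descFactorial_self] at h2
  have h3 : 0 < Nat.card {i : Fin (2 * p) → Fin p // kernelPartition i = π} :=
    h2 ▸ Nat.factorial_pos p
  obtain ⟨⟨i, hi⟩⟩ := (Nat.card_pos_iff.1 h3).1
  exact ⟨i, (indexes_iff π i).2 ((kernelPartition_eq_iff i π).1 hi)⟩

lemma card_filter_le_two [DecidableEq α] {π : Finpartition (Finset.univ : Finset (Fin m))}
    (h : π ∈ pairPartitions m) {i : Fin m → α} (hi : ∀ j k, i j = i k ↔ π.part j = π.part k)
    (v : α) : (Finset.univ.filter fun j => i j = v).card ≤ 2 := by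
  rcases (Finset.univ.filter fun j => i j = v).eq_empty_or_nonempty with h0 | ⟨j, hj⟩
  · simp [h0]
  · rw [← mem_pairPartitions.1 h _ (π.part_mem.2 (Finset.mem_univ j))]
    refine Finset.card_le_card fun k hk => ?_
    simp only [Finset.mem_filter, Finset.mem_univ, true_and] at hj hk
    rw [π.mem_part_iff_part_eq_part (Finset.mem_univ _) (Finset.mem_univ _), ← hi, hj, hk]

/-- An index sequence with values in `ℕ` representing a partition. -/
def blockCode (π : Finpartition (Finset.univ : Finset (Fin m))) (j : Fin m) : ℕ :=
  Encodable.encode (π.part j)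

lemma blockCode_eq_iff (π : Finpartition (Finset.univ : Finset (Fin m))) (j k : Fin m) :
    blockCode π j = blockCode π k ↔ π.part j = π.part k :=
  Encodable.encode_inj

end Partitions

/-! ### The central limit theorem for exchangeable sequences. -/

section CentralLimit

lemma tendsto_inv_sqrt_pow_mul_descFactorial_one (k : ℕ) :
    Tendsto (fun n : ℕ => (√(n : ℝ))⁻¹ ^ (2 * k) * (n.descFactorial k : ℝ)) atTop (𝓝 1) := by
  have h := (Asymptotics.isEquivalent_iff_tendsto_one
    (by filter_upwards [eventually_gt_atTop 0] with n hn; positivity)).1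
      (isEquivalent_descFactorial k)
  refine h.congr fun n => ?_
  rw [pow_mul, inv_pow, Real.sq_sqrt (by positivity), Pi.div_apply, inv_pow, div_eq_inv_mul]

lemma tendsto_inv_sqrt_pow_mul_descFactorial_zero {k m : ℕ} (h : 2 * k < m) :
    Tendsto (fun n : ℕ => (√(n : ℝ))⁻¹ ^ m * (n.descFactorial k : ℝ)) atTop (𝓝 0) := by
  have h1 : Tendsto (fun n : ℕ => (√(n : ℝ))⁻¹) atTop (𝓝 0) :=
    tendsto_inv_atTop_zero.comp (Real.tendsto_sqrt_atTop.comp tendsto_natCast_atTop_atTop)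
  -- The first `2 * k` factors balance the falling factorial; the surplus ones tend to 0.
  have h2 := (h1.pow (m - 2 * k)).mul (tendsto_inv_sqrt_pow_mul_descFactorial_one k)
  rw [zero_pow (by omega), zero_mul] at h2
  refine h2.congr fun n => ?_
  rw [← mul_assoc, ← pow_add]
  congr 2
  omega

variable {A : Type*} [Ring A] [Algebra ℂ A]

/-- By `hexch` all index sequences with kernel `π` contribute equally; `blockCode π` serves as their
representative. -/
lemma apply_normalized_sum_pow (φ : A →ₗ[ℂ] ℂ) (b : ℕ → A)
    (hexch : ∀ {m : ℕ} (i i' : Fin m → ℕ), (∀ j k, i j = i k ↔ i' j = i' k) →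
      φ (List.ofFn fun j => b (i j)).prod = φ (List.ofFn fun j => b (i' j)).prod)
    (c : ℂ) (n m : ℕ) :
    φ ((c • ∑ k ∈ Finset.range n, b k) ^ m) =
      ∑ π : Finpartition (Finset.univ : Finset (Fin m)), c ^ m * (n.descFactorial π.parts.card) *
        φ (List.ofFn fun j => b (blockCode π j)).prod := by
  classical
  rw [smul_pow, ← MultilinearMap.mkPiAlgebraFin_apply_const (R := ℂ) (A := A) (n := m),
    Finset.sum_range, MultilinearMap.map_sum, map_smul, map_sum, smul_eq_mul, Finset.mul_sum,
    ← Finset.sum_fiberwise Finset.univ kernelPartition]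
  refine Finset.sum_congr rfl fun π _ => ?_
  rw [← card_kernelPartition_eq π n, Nat.card_eq_fintype_card, Fintype.card_subtype,
    mul_right_comm, mul_comm _ (Nat.cast _), ← nsmul_eq_mul, ← Finset.sum_const]
  refine Finset.sum_congr rfl fun i hi => ?_
  rw [Finset.mem_filter, kernelPartition_eq_iff] at hi
  rw [MultilinearMap.mkPiAlgebraFin_apply,
    hexch (fun j => ((i j : Fin n) : ℕ)) (blockCode π) fun j k => ?_]
  rw [Fin.val_inj, blockCode_eq_iff, hi.2]

/-- The central limit theorem for exchangeable sequences with vanishing singleton moments. -/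
theorem tendsto_normalized_sum_pow (φ : A →ₗ[ℂ] ℂ) (b : ℕ → A)
    (hexch : ∀ {m : ℕ} (i i' : Fin m → ℕ), (∀ j k, i j = i k ↔ i' j = i' k) →
      φ (List.ofFn fun j => b (i j)).prod = φ (List.ofFn fun j => b (i' j)).prod)
    (hsing : ∀ {m : ℕ} (i : Fin m → ℕ) (k : Fin m), (∀ j, j ≠ k → i j ≠ i k) →
      φ (List.ofFn fun j => b (i j)).prod = 0) (m : ℕ) :
    Tendsto (fun n : ℕ => φ ((((√(n : ℝ) : ℝ) : ℂ)⁻¹ • ∑ k ∈ Finset.range n, b k) ^ m)) atTop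
      (𝓝 (∑ π ∈ pairPartitions m, φ (List.ofFn fun j => b (blockCode π j)).prod)) := by
  classical
  simp only [apply_normalized_sum_pow φ b hexch]
  -- The limit is extended by zero to all partitions, so that convergence can be checked term by
  -- term.
  rw [← Finset.univ_inter (pairPartitions m), ← Finset.sum_ite_mem]
  refine tendsto_finsetSum _ fun π _ => ?_
  have hcast : ∀ n : ℕ, ((√(n : ℝ) : ℝ) : ℂ)⁻¹ ^ m * (n.descFactorial π.parts.card : ℂ) =
      (((√(n : ℝ))⁻¹ ^ m * (n.descFactorial π.parts.card : ℝ) : ℝ) : ℂ) := by simp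
  simp only [hcast]
  split_ifs with hπ
  · have h := (Complex.continuous_ofReal.tendsto _).comp
      (tendsto_inv_sqrt_pow_mul_descFactorial_one π.parts.card)
    rw [two_mul_card_parts_of_mem_pairPartitions hπ] at h
    simpa using h.mul_const (φ (List.ofFn fun j => b (blockCode π j)).prod)
  · by_cases h1 : ∀ V ∈ π.parts, V.card ≠ 1
    · have h := (Complex.continuous_ofReal.tendsto _).comp
        (tendsto_inv_sqrt_pow_mul_descFactorial_zero (two_mul_card_parts_lt hπ h1))
      simpa using h.mul_const (φ (List.ofFn fun j => b (blockCode π j)).prod)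
    · push Not at h1
      obtain ⟨V, hV, hV1⟩ := h1
      obtain ⟨k, rfl⟩ := Finset.card_eq_one.1 hV1
      rw [hsing (blockCode π) k fun j hj h => hj ?_]
      · simp
      · rw [blockCode_eq_iff, π.part_eq_of_mem hV (Finset.mem_singleton_self k)] at h
        exact Finset.mem_singleton.1 (h ▸ π.mem_part (Finset.mem_univ j))

end CentralLimit
end TensorFreeCLT

namespace TensorFreeCLT

open Polynomial Filter Topology

/-! ### Positive functionals and their tensor squares. -/

section Positivity

variable {A : Type*} [Ring A] [StarRing A] [Algebra ℂ A] [StarModule ℂ A] {τ : A →ₗ[ℂ] ℂ}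

/-- A positive functional is hermitian. -/
lemma apply_star_of_nonneg (h : ∀ x, 0 ≤ τ (star x * x)) (x : A) :
    τ (star x) = star (τ x) := by
  -- Polarization: the diagonal terms of `star (1 + c • x) * (1 + c • x)` have real value. Taking `c
  -- = 1` and `c = I` gives the two parts of the claim.
  have key : ∀ c : ℂ, (c * τ x + star c * τ (star x)).im = 0 := fun c => by
    have h0 := (Complex.le_def.1 (h (1 + c • x))).2
    have h1 := (Complex.le_def.1 (h 1)).2
    have h2 := (Complex.le_def.1 (h (c • x))).2
    have e : star (1 + c • x) * (1 + c • x) =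
        star 1 * 1 + star (c • x) * (c • x) + (c • x + star c • star x) := by
      simp only [star_add, star_smul, star_one, add_mul, mul_add, one_mul, mul_one]
      abel
    rw [e, map_add, map_add, Complex.add_im, Complex.add_im, ← h1, ← h2, map_add, map_smul,
      map_smul, smul_eq_mul, smul_eq_mul] at h0
    simpa using h0.symm
  have h1 := key 1
  have h2 := key Complex.I
  simp at h1 h2
  apply Complex.ext
  · simp only [Complex.star_def, Complex.conj_re]; linarith
  · simp only [Complex.star_def, Complex.conj_im]; linarith

/-- The degenerate case of the Cauchy-Schwarz inequality. -/
lemma apply_mul_eq_zero_of_nonneg (h : ∀ x, 0 ≤ τ (star x * x)) {x : A}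
    (hx : τ (star x * x) = 0) (y : A) : τ (star y * x) = 0 := by
  by_contra hd
  set d := τ (star y * x) with hd'
  have hd2 : τ (star x * y) = star d := by
    rw [hd', ← apply_star_of_nonneg h, star_mul, star_star]
  have hpos : 0 < Complex.normSq d := Complex.normSq_pos.2 hd
  -- Since `τ (star x * x) = 0`, the quadratic term in `t` disappears; the remaining affine function
  -- cannot stay nonnegative. The `t` chosen below gives it the value `-1`.
  have key : ∀ t : ℝ, 0 ≤ (τ (star y * y)).re - 2 * t * Complex.normSq d := fun t => by
    have h0 := (Complex.le_def.1 (h (y - ((t : ℂ) * star d) • x))).1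
    have e : star (y - ((t : ℂ) * star d) • x) * (y - ((t : ℂ) * star d) • x) =
        star y * y - ((t : ℂ) * star d) • (star y * x) - ((t : ℂ) * d) • (star x * y)
          + (((t : ℂ) * d) * ((t : ℂ) * star d)) • (star x * x) := by
      simp only [star_sub, star_smul, star_mul', Complex.star_def, Complex.conj_ofReal,
        Complex.conj_conj, sub_mul, mul_sub, smul_mul_assoc, mul_smul_comm]
      module
    rw [e, map_add, map_sub, map_sub, map_smul, map_smul, map_smul, hx, hd2, ← hd'] at h0
    simp [Complex.normSq_apply] at h0 ⊢
    nlinarith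
  have h1 := key (((τ (star y * y)).re + 1) / (2 * Complex.normSq d))
  have h2 : 2 * (((τ (star y * y)).re + 1) / (2 * Complex.normSq d)) * Complex.normSq d =
      (τ (star y * y)).re + 1 := by field_simp
  linarith

lemma posSemidef_gram (h : ∀ x, 0 ≤ τ (star x * x)) {κ : Type*} [Fintype κ] (u : κ → A) :
    (Matrix.of fun i j => τ (star (u i) * u j)).PosSemidef := by
  rw [Matrix.posSemidef_iff_dotProduct_mulVec]
  refine ⟨?_, fun c => ?_⟩
  · ext i j
    simp [Matrix.conjTranspose_apply, ← apply_star_of_nonneg h, -Complex.star_def]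
  · convert h (∑ i, c i • u i) using 1
    simp only [dotProduct, Matrix.mulVec, star_sum, Finset.sum_mul_sum, map_sum, star_smul,
      smul_mul_smul_comm, map_smul, Pi.star_apply, Matrix.of_apply, smul_eq_mul]
    simp only [Finset.mul_sum]
    exact Finset.sum_congr rfl fun i _ => Finset.sum_congr rfl fun j _ => by ring

/-- The tensor square of a positive functional is positive. -/
theorem tensorState_nonneg (h : ∀ x, 0 ≤ τ (star x * x)) (z : A ⊗[ℂ] A) :
    0 ≤ tensorState τ (star z * z) := by
  obtain ⟨S, rfl⟩ := TensorProduct.exists_finset z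
  -- The Schur product of the Gram matrices of the two legs is positive semidefinite; its quadratic
  -- form at the all-ones vector is the required value.
  have hp := ((posSemidef_gram h fun i : S => i.1.1).hadamard
    (posSemidef_gram h fun i : S => i.1.2)).dotProduct_mulVec_nonneg 1
  rw [← Finset.sum_coe_sort]
  convert hp using 1
  simp [dotProduct, Matrix.mulVec, star_sum, Finset.sum_mul_sum, tensorState_tmul]

end Positivity

/-! ### Realizing limiting moments in a faithful tracial space. -/

section Representation

/-- Every positive unital functional on a commutative `*`-algebra factors through a faithful
state. -/
theorem exists_faithful_quotient {R : Type} [CommRing R] [StarRing R] [Algebra ℂ R]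
    [StarModule ℂ R] (L : R →ₗ[ℂ] ℂ) (h1 : L 1 = 1) (hL : ∀ x, 0 ≤ L (star x * x)) :
    ∃ (A' : Type) (_ : Ring A') (_ : StarRing A') (_ : Algebra ℂ A') (_ : StarModule ℂ A')
      (τ' : A' →ₗ[ℂ] ℂ) (q : R →ₐ[ℂ] A'), IsFaithfulTracialState τ' ∧
        (∀ x, q (star x) = star (q x)) ∧ ∀ x, τ' (q x) = L x := by
  -- The radical of the form is an ideal by construction; the degenerate Cauchy-Schwarz inequality
  -- later shows that it contains every `x` with `L (star x * x) = 0`, which gives faithfulness.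
  let N : Ideal R :=
    { carrier := {x | ∀ y, L (y * x) = 0}
      add_mem' := fun {a b} ha hb y => by rw [mul_add, map_add, ha, hb, add_zero]
      zero_mem' := fun y => by simp
      smul_mem' := fun c x hx y => by rw [smul_eq_mul, ← mul_assoc, hx] }
  have hN : ∀ {x}, x ∈ N ↔ ∀ y, L (y * x) = 0 := Iff.rfl
  have hstar : ∀ x ∈ N, star x ∈ N := fun x hx y => by
    have := hN.1 hx (star y)
    rw [← star_star (y * star x), apply_star_of_nonneg hL, star_mul', star_star, this, star_zero]
  let s : R ⧸ N →+* R ⧸ N := Ideal.Quotient.lift N ((Ideal.Quotient.mk N).comp (starRingEnd R))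
    fun x hx => Ideal.Quotient.eq_zero_iff_mem.2 (hstar x hx)
  have hs : ∀ x, s (Ideal.Quotient.mk N x) = Ideal.Quotient.mk N (star x) := fun x => rfl
  have hmk : Function.Surjective (Ideal.Quotient.mk N) := Ideal.Quotient.mk_surjective
  let iS : StarRing (R ⧸ N) :=
    { star := s
      star_involutive := fun x => by
        obtain ⟨x, rfl⟩ := hmk x
        rw [hs, hs, star_star]
      star_mul := fun x y => (map_mul s x y).trans (mul_comm _ _)
      star_add := map_add s }
  have hst : ∀ x, star (Ideal.Quotient.mk N x) = Ideal.Quotient.mk N (star x) := hs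
  let t : R ⧸ N →ₗ[ℂ] ℂ :=
    { toFun := QuotientAddGroup.lift _ L.toAddMonoidHom fun x hx => by
        simpa using hN.1 (show x ∈ N from hx) 1
      map_add' := map_add _
      map_smul' := fun c x => by
        obtain ⟨x, rfl⟩ := hmk x
        exact map_smul L c x }
  have ht : ∀ x, t (Ideal.Quotient.mk N x) = L x := fun x => rfl
  refine ⟨R ⧸ N, inferInstance, iS, inferInstance, ⟨fun c x => ?_⟩, t, Ideal.Quotient.mkₐ ℂ N,
    ⟨?_, fun x => ?_, fun x hx => ?_, fun x y => by rw [mul_comm]⟩, fun x => (hst x).symm, ht⟩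
  · obtain ⟨x, rfl⟩ := hmk x
    change s (Ideal.Quotient.mk N (c • x)) = star c • s (Ideal.Quotient.mk N x)
    rw [hs, hs, star_smul]
    rfl
  · rw [← map_one (Ideal.Quotient.mk N), ht, h1]
  · obtain ⟨x, rfl⟩ := hmk x
    rw [hst, ← map_mul, ht]
    exact hL x
  · obtain ⟨x, rfl⟩ := hmk x
    rw [hst, ← map_mul, ht] at hx
    refine Ideal.Quotient.eq_zero_iff_mem.2 (hN.2 fun y => ?_)
    simpa using apply_mul_eq_zero_of_nonneg hL hx (star y)

/-- Conjugation of coefficients makes `ℂ[X]` a `*`-algebra in which `X` is self-adjoint. -/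
noncomputable instance polynomialStarRing : StarRing ℂ[X] where
  star := mapRingHom (starRingEnd ℂ)
  star_involutive p := by simp [Polynomial.map_map]
  star_mul p q := by rw [mul_comm p q, map_mul]
  star_add := map_add _

lemma polynomial_star_def (p : ℂ[X]) : star p = p.map (starRingEnd ℂ) := rfl

instance : StarModule ℂ ℂ[X] where
  star_smul c p := by simp [polynomial_star_def, smul_eq_C_mul]

lemma aeval_star {A : Type*} [Ring A] [StarRing A] [Algebra ℂ A] [StarModule ℂ A] {x : A}
    (hx : IsSelfAdjoint x) (p : ℂ[X]) : aeval x (star p) = star (aeval x p) := by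
  induction p using Polynomial.induction_on' with
  | add p q hp hq => simp only [star_add, map_add, hp, hq]
  | monomial n c =>
    simp [polynomial_star_def, aeval_monomial, Algebra.algebraMap_eq_smul_one, star_smul,
      (hx.pow n).star_eq, -Complex.star_def]

/-- A limit of moment sequences of self-adjoint elements is the moment sequence of a self-adjoint
element of a `*`-algebra with a faithful tracial state. -/
theorem exists_of_tendsto_moments {A : Type*} [Ring A] [StarRing A] [Algebra ℂ A] [StarModule ℂ A]
    {φ : A →ₗ[ℂ] ℂ} (h1 : φ 1 = 1) (hφ : ∀ x, 0 ≤ φ (star x * x)) {x : ℕ → A}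
    (hx : ∀ n, IsSelfAdjoint (x n)) {M : ℕ → ℂ}
    (hM : ∀ m, Tendsto (fun n => φ (x n ^ m)) atTop (𝓝 (M m))) :
    ∃ (A' : Type) (_ : Ring A') (_ : StarRing A') (_ : Algebra ℂ A') (_ : StarModule ℂ A')
      (τ' : A' →ₗ[ℂ] ℂ) (S : A'), IsFaithfulTracialState τ' ∧ IsSelfAdjoint S ∧
        ∀ m, τ' (S ^ m) = M m := by
  let L : ℂ[X] →ₗ[ℂ] ℂ := (basisMonomials ℂ).constr ℂ M
  have hLm : ∀ m, L (monomial m 1) = M m := fun m => by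
    simpa using (basisMonomials ℂ).constr_basis ℂ M m
  have hlim : ∀ p, Tendsto (fun n => φ (aeval (x n) p)) atTop (𝓝 (L p)) := fun p => by
    induction p using Polynomial.induction_on' with
    | add p q hp hq => simpa only [map_add] using hp.add hq
    | monomial m c =>
      have e : monomial m c = c • monomial m (1 : ℂ) := by simp [smul_monomial]
      simp only [e, map_smul, hLm]
      simpa [aeval_monomial] using (hM m).const_mul c
  have hL1 : L 1 = 1 := tendsto_nhds_unique (hlim 1) (by simp [h1])
  -- Self-adjointness of `x n` turns evaluation into a `*`-homomorphism, so positivity of `φ` passes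
  -- to the limit.
  have hL : ∀ p, 0 ≤ L (star p * p) := fun p => by
    refine ge_of_tendsto' (hlim _) fun n => ?_
    rw [map_mul, aeval_star (hx n)]
    exact hφ _
  obtain ⟨A', _, _, _, _, τ', q, hτ', hq, hqL⟩ := exists_faithful_quotient L hL1 hL
  refine ⟨A', _, _, _, ‹_›, τ', q X, hτ', ?_, fun m => ?_⟩
  · rw [IsSelfAdjoint, ← hq, polynomial_star_def, map_X]
  · rw [← map_pow, hqL, X_pow_eq_monomial, hLm]

end Representation

/-! ### Assembly for the normalized sums. -/

section Main

variable {A : Type*} [Ring A] [StarRing A] [Algebra ℂ A] {τ : A →ₗ[ℂ] ℂ} {a : ℕ → A} {lam σ : ℝ}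

lemma isSelfAdjoint_normalizedSum [StarModule ℂ A] (ha : IsFreeIID τ a)
    (hmean : τ (a 0) = (lam : ℂ)) (n : ℕ) : IsSelfAdjoint (normalizedSum τ a n) := by
  have hreal : ∀ r : ℝ, IsSelfAdjoint ((r : ℂ)⁻¹) := fun r => by
    simp [IsSelfAdjoint]
  refine (hreal _).smul (isSelfAdjoint_sum _ fun k _ => (hreal _).smul (IsSelfAdjoint.sub ?_ ?_))
  · rw [IsSelfAdjoint, TensorProduct.star_tmul, (ha.selfAdjoint k).star_eq]
  · rw [tensorState_tmul, ha.mean_eq hmean, Algebra.algebraMap_eq_smul_one]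
    refine IsSelfAdjoint.smul ?_ (IsSelfAdjoint.one _)
    simp [IsSelfAdjoint]

/-- The central limit theorem for `a k ⊗ a k`. -/
theorem tendsto_tensorState_normalizedSum (hτ : IsFaithfulTracialState τ) (ha : IsFreeIID τ a)
    (hmean : τ (a 0) = (lam : ℂ)) (m : ℕ) :
    Tendsto (fun n => tensorState τ (normalizedSum τ a n ^ m)) atTop
      (𝓝 (∑ π ∈ pairPartitions m,
        tensorState τ (List.ofFn fun j => centeredTensor τ a (blockCode π j)).prod)) := by
  have hx := ha.isFreeWithLaw_sub hτ (lam : ℂ)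
  refine tendsto_normalized_sum_pow (tensorState τ) (centeredTensor τ a) (fun i i' h => ?_)
    (fun i k hk => ?_) m
  · simp only [ha.centeredTensor_eq hmean]
    exact hx.tensorState_prod_eq _ _ h
  · simp only [ha.centeredTensor_eq hmean]
    refine hx.tensorState_prod_eq_zero ?_ _ _ hk
    simp [hmean, Algebra.algebraMap_eq_smul_one, hτ.map_one]

/-- The moments over pair partitions depend only on the mean and the variance. -/
theorem tensorState_prod_centeredTensor_eq {B : Type*} [Ring B] [StarRing B] [Algebra ℂ B]
    {ρ : B →ₗ[ℂ] ℂ} {c : ℕ → B}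
    (hτ : IsFaithfulTracialState τ) (ha : IsFreeIID τ a)
    (hmean : τ (a 0) = (lam : ℂ)) (hvar : variance τ (a 0) = (σ : ℂ) ^ 2)
    (hρ : IsFaithfulTracialState ρ) (hc : IsFreeIID ρ c)
    (hmean' : ρ (c 0) = (lam : ℂ)) (hvar' : variance ρ (c 0) = (σ : ℂ) ^ 2) {m : ℕ}
    {π : Finpartition (Finset.univ : Finset (Fin m))} (hπ : π ∈ pairPartitions m)
    {i i' : Fin m → ℕ} (hi : ∀ j k, i j = i k ↔ π.part j = π.part k)
    (hi' : ∀ j k, i' j = i' k ↔ π.part j = π.part k) :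
    tensorState τ (List.ofFn fun j => centeredTensor τ a (i j)).prod =
      tensorState ρ (List.ofFn fun j => centeredTensor ρ c (i' j)).prod := by
  have hδ : tensorStdDev τ a = tensorStdDev ρ c := by
    rw [tensorStdDev, tensorStdDev, hτ.variance_tensor hmean hvar, hρ.variance_tensor hmean' hvar']
  simp only [ha.centeredTensor_eq hmean, hc.centeredTensor_eq hmean', hδ]
  refine (ha.isFreeWithLaw_sub hτ (lam : ℂ)).tensorState_prod_eq_of_card_le_two
    (hc.isFreeWithLaw_sub hρ (lam : ℂ)) ?_ ?_ ?_ _ _ (fun j k => (hi j k).trans (hi' j k).symm)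
    (card_filter_le_two hπ hi)
  · simp [hmean, Algebra.algebraMap_eq_smul_one, hτ.map_one]
  · simp [hmean', Algebra.algebraMap_eq_smul_one, hρ.map_one]
  · rw [variance, hmean] at hvar
    rw [variance, hmean'] at hvar'
    simp only [LinearMap.comp_apply, AlgHom.toLinearMap_apply, map_pow, aeval_X, hvar, hvar']

end Main

end TensorFreeCLT

theorem proposition4p2
    {A : Type u} [Ring A] [StarRing A] [Algebra ℂ A] [StarModule ℂ A]
    (τ : A →ₗ[ℂ] ℂ) (hτ : TensorFreeCLT.IsFaithfulTracialState τ)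
    (a : ℕ → A) (ha : TensorFreeCLT.IsFreeIID τ a)
    (lam σ : ℝ) (hσ : σ ≠ 0)
    (hmean : τ (a 0) = (lam : ℂ))
    (hvar : TensorFreeCLT.variance τ (a 0) = (σ : ℂ) ^ 2) :
    TensorFreeCLT.variance (TensorFreeCLT.tensorState τ) (a 0 ⊗ₜ[ℂ] a 0) =
        (σ : ℂ) ^ 2 * ((σ : ℂ) ^ 2 + 2 * (lam : ℂ) ^ 2) ∧
    ∃ (A' : Type) (_ : Ring A') (_ : StarRing A') (_ : Algebra ℂ A') (_ : StarModule ℂ A')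
      (τ' : A' →ₗ[ℂ] ℂ) (S : A'),
      TensorFreeCLT.IsFaithfulTracialState τ' ∧
      IsSelfAdjoint S ∧
      -- the normalized sums converge in distribution to `S`
      TensorFreeCLT.ConvergesInDistribution (TensorFreeCLT.tensorState τ)
        (TensorFreeCLT.normalizedSum τ a) τ' S ∧
      -- the odd moments of `S` vanish
      (∀ p : ℕ, τ' (S ^ (2 * p + 1)) = 0) ∧
      -- the even moments of `S` are sums over pair partitions, where each pair partition may be
      -- represented by any index sequence with values in a `p`-element set (and such exist)
      (∀ p : ℕ,
        (∀ π ∈ TensorFreeCLT.pairPartitions (2 * p),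
          ∃ i : Fin (2 * p) → Fin p, TensorFreeCLT.Indexes π i) ∧
        ∀ i : Finpartition (Finset.univ : Finset (Fin (2 * p))) → Fin (2 * p) → Fin p,
          (∀ π ∈ TensorFreeCLT.pairPartitions (2 * p), TensorFreeCLT.Indexes π (i π)) →
          τ' (S ^ (2 * p)) =
            ∑ π ∈ TensorFreeCLT.pairPartitions (2 * p),
              TensorFreeCLT.tensorState τ
                (List.ofFn fun j => TensorFreeCLT.centeredTensor τ a (i π j)).prod) ∧
      -- the law of `S` depends only on `lam` and `σ`: every other sequence, in any space, with
      -- the same mean and variance has normalized sums converging to the same `S`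
      (∀ (B : Type v) [Ring B] [StarRing B] [Algebra ℂ B] [StarModule ℂ B]
        (ρ : B →ₗ[ℂ] ℂ) (c : ℕ → B),
        TensorFreeCLT.IsFaithfulTracialState ρ → TensorFreeCLT.IsFreeIID ρ c →
        ρ (c 0) = (lam : ℂ) → TensorFreeCLT.variance ρ (c 0) = (σ : ℂ) ^ 2 →
        TensorFreeCLT.ConvergesInDistribution (TensorFreeCLT.tensorState ρ)
          (TensorFreeCLT.normalizedSum ρ c) τ' S) := by
  have hlim := TensorFreeCLT.tendsto_tensorState_normalizedSum hτ ha hmean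
  refine ⟨hτ.variance_tensor hmean hvar, ?_⟩
  obtain ⟨A', i1, i2, i3, i4, τ', S, hτ', hS, hmom⟩ := TensorFreeCLT.exists_of_tendsto_moments
    (φ := TensorFreeCLT.tensorState τ)
    (by simp [Algebra.TensorProduct.one_def, TensorFreeCLT.tensorState_tmul, hτ.map_one])
    (TensorFreeCLT.tensorState_nonneg hτ.nonneg)
    (TensorFreeCLT.isSelfAdjoint_normalizedSum ha hmean) hlim
  refine ⟨A', i1, i2, i3, i4, τ', S, hτ', hS, fun m => by rw [hmom]; exact hlim m, fun p => ?_,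
    fun p => ⟨fun π hπ => TensorFreeCLT.exists_indexes hπ, fun i hi => ?_⟩, ?_⟩
  · rw [hmom]
    refine Finset.sum_eq_zero fun π hπ => ?_
    have := TensorFreeCLT.two_mul_card_parts_of_mem_pairPartitions hπ
    -- A pairing of `2 * p + 1` points would make this number even.
    omega
  · rw [hmom]
    refine Finset.sum_congr rfl fun π hπ => ?_
    have h := (TensorFreeCLT.indexes_iff π (i π)).1 (hi π hπ)
    -- Both sequences are taken to be `a`; only the representatives `blockCode π` and `i π` differ.
    exact TensorFreeCLT.tensorState_prod_centeredTensor_eq hτ ha hmean hvar hτ ha hmean hvar hπ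
      (TensorFreeCLT.blockCode_eq_iff π) fun j k => Fin.val_inj.trans (h j k)
  · intro B _ _ _ _ ρ c hρ hc hmean' hvar' m
    rw [hmom, Finset.sum_congr rfl fun π hπ =>
      TensorFreeCLT.tensorState_prod_centeredTensor_eq hτ ha hmean hvar hρ hc hmean' hvar' hπ
        (TensorFreeCLT.blockCode_eq_iff π) (TensorFreeCLT.blockCode_eq_iff π)]
    exact TensorFreeCLT.tendsto_tensorState_normalizedSum hρ hc hmean' m
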